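/- Let $N$ be a nonempty connected directed graph (loops and parallel edges allowed) with $n$ nodes and $m$ edges, and let $\theta_e:\mathbb R\to\mathbb R$, $e\in E(N)$, be convex functions that attain a minimum. For $X\in\mathbb Z^{E}$ put $H(X)=\sum_e\theta_e(x_e)$, $g_i(X)=\sum_{e\text{ leaving }i}x_e-\sum_{e\text{ entering }i}x_e$ and $G(X)=\frac12\sum_i|g_i(X)|$; $X$ is a circulation if $g_i(X)=0$ for all $i$. For a potential $\pi$ on the nodes and an edge $e=(i,j)$ define the reduced costs $$c^\pi_{ij}(X)=\theta_e(x_e+1)-\theta_e(x_e)-\pi_j+\pi_i,\qquad c^\pi_{ji}(X)=\theta_e(x_e-1)-\theta_e(x_e)+\pi_j-\pi_i .$$ $X$ is dual feasible with potential $\pi$ if all of them are nonnegative. The residual network has two arcs for every edge $e=(i,j)$: one from $j$ to $i$ with weight $c^\pi_{ij}$, along which $x_e$ increases by $1$, and one from $i$ to $j$ with weight $c^\pi_{ji}$, along which $x_e$ decreases by $1$. The successive shortest path algorithm starts with $\pi=0$ and with a vector $X_s\in\mathbb Z^{E}$ each of whose components minimises $\theta_e$ over $\mathbb Z$. While some node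 $s$ has $g_s(X)>0$, it computes the distances $d(v)$ from $s$ to all nodes $v$ in the residual network, chooses a node $t$ with $g_t(X)<0$, changes $X$ by one unit along each arc of a shortest (simple) path from $s$ to $t$, and replaces $\pi$ by $\pi-d$. Running times are counted in a unit-cost model in which an arithmetic operation, a comparison, an array access, an evaluation of some $\theta_e$, and the computation of an integer minimiser of a single $\theta_e$ take one step. $S(p,q)\ge p+q$ denotes a bound on the time that a given correct shortest path subroutine needs in a network with $p$ nodes and $q$ arcs of nonnegative weight in which all nodes are reachable from the source. The constants in $O(\cdot)$ are absolute. 1. A vector $X_s$ as above exists. For every such $X_s$, and for all choices of $s$, $t$ and the shortest paths, $X$ is dual feasible with potential $\pi$ at every stage, the algorithm never gets stuck, it stops after exactly $G(X_s)$ iterations (one shortest path search with nonnegative weights in each), and the final $X$ is a circulation that minimises $H$ among all integer circulations. The algorithm (as an explicit program) runs in time $O\big((G(X_s)+1)\cdot S(n,2m)\big)$. If there is a real circulation $(y_e)$ such that $y_e$ is the unique minimiser of $\theta_e$ over $\mathbb R$ for every $e$, then $G(X_s)\le m$. 2. Let $D=(V,E)$ be a planar directed graph with a plane embedding, and let $D^*=(V^*,E)$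 be the dual graph. If $X$ is an optimal integer circulation of $D^*$ for arbitrary functions $\theta_e$, then there is $h\in\mathbb Z^V$ with $x_e=h_i-h_j$ for all $e=(i,j)\in E$, and every such $h$ minimises $\sum_{e=(i,j)\in E}\theta_e(h_i-h_j)$ over $\mathbb Z^V$. 3. (Disordered SOS model.) Let $D$ be as in 2, let $d\in\mathbb R^V$, and let $\theta_e(x)=(d_i-d_j+x)^2$ for $e=(i,j)$. Then $G(X_s)\le|E|$ in $D^*$. Applied to $D^*$, the algorithm finds an optimal integer circulation $X$ after $G(X_s)\le|E|$ shortest path searches and, if $E\ne\emptyset$, in time $O(|E|\cdot S(|V^*|,2|E|))$. There is $h\in\mathbb Z^V$ with $x_e=h_i-h_j$ for all $e=(i,j)$, and every such $h$ is a ground state, that is, it minimises $\sum_{(i,j)\in E}\big((d_i+h_i)-(d_j+h_j)\big)^2$ over $\mathbb Z^V$. 4. The Bellman–Ford search is a correct shortest path subroutine with $S(p,q)=O((p+1)(q+1))$. With it the algorithm solves the problem in 3 in polynomial time, namely in time $O(|V^*|\cdot|E|^2)$ if $E\neq\emptyset$. -/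

import Mathlib

/-! ## Directed multigraphs -/

/-- A finite directed graph with `n` nodes and `m` edges; loops and parallel edges are allowed. -/
structure Net (n m : ℕ) where
  tail : Fin m → Fin n
  head : Fin m → Fin n

namespace Net

variable {n m : ℕ}

/-- The number of connected components (orientations ignored, isolated nodes counted). -/
noncomputable def numComponents (N : Net n m) : ℕ :=
  Nat.card (Quot fun u v : Fin n => ∃ e, N.tail e = u ∧ N.head e = v)

/-- The graph is nonempty and connected (orientations ignored). -/
def Connected (N : Net n m) : Prop := N.numComponents = 1

/-- `N.IsWalk l u v`: the list of edges `l` is a directed walk from `u` to `v`. -/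
def IsWalk (N : Net n m) : List (Fin m) → Fin n → Fin n → Prop
  | [], u, v => u = v
  | a :: l, u, v => N.tail a = u ∧ N.IsWalk l (N.head a) v

/-- A directed path: a walk that visits no node twice. -/
def IsPath (N : Net n m) (l : List (Fin m)) (u v : Fin n) : Prop :=
  N.IsWalk l u v ∧ (u :: l.map N.head).Nodup

end Net

/-- The length of a walk with respect to edge weights `w`. -/
def walkWeight {m : ℕ} (w : Fin m → ℝ) (l : List (Fin m)) : ℝ := (l.map w).sum

/-- `δ` is the shortest-path distance from `u` to `v`. -/
def IsDistance {n m : ℕ} (N : Net n m) (w : Fin m → ℝ) (u v : Fin n) (δ : ℝ) : Prop :=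
  (∃ l, N.IsWalk l u v ∧ walkWeight w l = δ) ∧ ∀ l, N.IsWalk l u v → δ ≤ walkWeight w l

/-- `l` is a shortest path from `u` to `v`. -/
def IsShortestPath {n m : ℕ} (N : Net n m) (w : Fin m → ℝ) (u v : Fin n)
    (l : List (Fin m)) : Prop :=
  N.IsPath l u v ∧ IsDistance N w u v (walkWeight w l)

/-! ## Convex-cost circulations -/

section Circulation

variable {n m : ℕ}

/-- The excess `g_i(x)`: the sum of `x` over edges leaving `i` minus the sum over edges
entering `i`. -/
def excess {R : Type} [AddCommGroup R] (N : Net n m) (x : Fin m → R) (i : Fin n) : R :=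
  ∑ e with N.tail e = i, x e - ∑ e with N.head e = i, x e

def IsCirculation {R : Type} [AddCommGroup R] (N : Net n m) (x : Fin m → R) : Prop :=
  ∀ i, excess N x i = 0

/-- `G(x) = ½ ∑ |g_i(x)|`. -/
noncomputable def totalExcess (N : Net n m) (x : Fin m → ℤ) : ℝ :=
  (1 / 2) * ∑ i, |((excess N x i : ℤ) : ℝ)|

/-- The separable objective `H(x) = ∑ θ_e(x_e)` on integer vectors. -/
noncomputable def cost (θ : Fin m → ℝ → ℝ) (x : Fin m → ℤ) : ℝ := ∑ e, θ e (x e)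

/-- `x` is an integer circulation of minimum cost. -/
def IsOptimalCirculation (N : Net n m) (θ : Fin m → ℝ → ℝ) (x : Fin m → ℤ) : Prop :=
  IsCirculation N x ∧ ∀ y : Fin m → ℤ, IsCirculation N y → cost θ x ≤ cost θ y

/-- The integer vector `x` minimises every summand separately. -/
def IsTermwiseMin (θ : Fin m → ℝ → ℝ) (x : Fin m → ℤ) : Prop :=
  ∀ e, ∀ z : ℤ, θ e (x e) ≤ θ e z

/-- The network searched for augmenting paths. Every edge `e = (i, j)` can be traversed in both
directions: arc number `e` goes from `j` to `i` and stands for increasing `x_e` by one (which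
lowers `g_j` and raises `g_i`); arc number `m + e` goes from `i` to `j` and stands for
decreasing `x_e` by one. -/
def residualNet (N : Net n m) : Net n (m + m) where
  tail := Fin.addCases N.head N.tail
  head := Fin.addCases N.tail N.head

/-- The reduced costs: for `e = (i, j)`, arc `e` has weight
`θ_e(x_e + 1) - θ_e(x_e) - π_j + π_i` and arc `m + e` has weight
`θ_e(x_e - 1) - θ_e(x_e) + π_j - π_i`. -/
noncomputable def reducedCost (N : Net n m) (θ : Fin m → ℝ → ℝ) (x : Fin m → ℤ)
    (pot : Fin n → ℝ) : Fin (m + m) → ℝ :=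
  Fin.addCases
    (fun e => θ e (x e + 1) - θ e (x e) - pot (N.head e) + pot (N.tail e))
    (fun e => θ e (x e - 1) - θ e (x e) + pot (N.head e) - pot (N.tail e))

/-- `x` is dual feasible, with potential `pot`. -/
def DualFeasible (N : Net n m) (θ : Fin m → ℝ → ℝ) (x : Fin m → ℤ) (pot : Fin n → ℝ) : Prop :=
  ∀ a, 0 ≤ reducedCost N θ x pot a

/-- Change `x` by one unit along a residual arc. -/
def push (x : Fin m → ℤ) (a : Fin (m + m)) : Fin m → ℤ :=
  Fin.addCases (motive := fun _ => Fin m → ℤ)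
    (fun e => Function.update x e (x e + 1)) (fun e => Function.update x e (x e - 1)) a

/-- Change `x` by one unit along every arc of a path. -/
def augment (x : Fin m → ℤ) (l : List (Fin (m + m))) : Fin m → ℤ := l.foldl push x

end Circulation

/-! ## The successive shortest path algorithm as a nondeterministic procedure -/

/-- The variables of the algorithm: the vector `x` and the node potential. -/
structure SSPState (n m : ℕ) where
  x : Fin m → ℤ
  pot : Fin n → ℝ

section SSP

variable {n m : ℕ}

/-- The `while` condition fails. -/
def Halted (N : Net n m) (st : SSPState n m) : Prop := ¬ ∃ s, 0 < excess N st.x s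

/-- One pass through the `while` loop, for an arbitrary choice of `s`, of `t` and of the shortest
path from `s` to `t`. -/
def Iteration (N : Net n m) (θ : Fin m → ℝ → ℝ) (st st' : SSPState n m) : Prop :=
  ∃ (s t : Fin n) (d : Fin n → ℝ) (l : List (Fin (m + m))),
    0 < excess N st.x s ∧ excess N st.x t < 0 ∧
    (∀ v, IsDistance (residualNet N) (reducedCost N θ st.x st.pot) s v (d v)) ∧
    IsShortestPath (residualNet N) (reducedCost N θ st.x st.pot) s t l ∧
    st' = ⟨augment st.x l, fun v => st.pot v - d v⟩

/-- `Run N θ k st st'`: `k` passes through the loop can lead from `st` to `st'`. -/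
inductive Run (N : Net n m) (θ : Fin m → ℝ → ℝ) : ℕ → SSPState n m → SSPState n m → Prop
  | refl (st : SSPState n m) : Run N θ 0 st st
  | tail {k : ℕ} {st st' st'' : SSPState n m} :
      Run N θ k st st' → Iteration N θ st' st'' → Run N θ (k + 1) st st''

end SSP

/-! ## Programs with a step count

Unit-cost random-access model: integers and reals are stored in single cells. One step evaluates
an expression made of a bounded number of arithmetic operations, comparisons, evaluations of some
`θ_e` and array accesses. -/

/-- The result of a computation, with the number of steps it took. -/
structure Timed (α : Type) where
  val : α
  steps : ℕ

instance : Monad Timed where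
  pure a := ⟨a, 0⟩
  bind c f := ⟨(f c.val).val, c.steps + (f c.val).steps⟩

section Programs

variable {n m : ℕ}

/-- One step, with result `a`. -/
def step {α : Type} (a : α) : Timed α := ⟨a, 1⟩

/-- Fill an array of length `k`, one step for each entry. -/
def tabulate {α : Type} {k : ℕ} (f : Fin k → α) : Timed (Fin k → α) := ⟨f, k⟩

/-- Scan all nodes for one that satisfies `p`. -/
def findNode (p : Fin n → Prop) [DecidablePred p] : Timed (Option (Fin n)) :=
  ⟨(List.finRange n).find? fun i => decide (p i), n⟩

/-- What a shortest path search from `s` with target `t` returns: the distances from `s` to all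
nodes, and a path from `s` to `t`. -/
structure SearchResult (n m : ℕ) where
  dist : Fin n → ℝ
  path : List (Fin m)

/-- A subroutine that takes a network, arc weights, a source and a target. -/
abbrev Search : Type :=
  ∀ n m : ℕ, Net n m → (Fin m → ℝ) → Fin n → Fin n → Timed (SearchResult n m)

/-- Admissible inputs of a search: nonnegative weights, and all nodes reachable from the
source. -/
def SearchInput (N : Net n m) (w : Fin m → ℝ) (s : Fin n) : Prop :=
  (∀ a, 0 ≤ w a) ∧ ∀ v, ∃ l, N.IsWalk l s v

/-- The subroutine solves the shortest path problem for nonnegative weights. -/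
def IsShortestPathSearch (search : Search) : Prop :=
  ∀ (n m : ℕ) (N : Net n m) (w : Fin m → ℝ) (s t : Fin n), SearchInput N w s →
    (∀ v, IsDistance N w s v ((search n m N w s t).val.dist v)) ∧
    IsShortestPath N w s t (search n m N w s t).val.path

/-- `S n m` bounds the time of the search in networks with `n` nodes and `m` arcs. As usual,
`S n m` is at least the size `n + m` of the network. -/
def IsSearchTime (search : Search) (S : ℕ → ℕ → ℕ) : Prop :=
  ∀ n m : ℕ, n + m ≤ S n m ∧
    ∀ (N : Net n m) (w : Fin m → ℝ) (s t : Fin n), SearchInput N w s →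
      (search n m N w s t).steps ≤ S n m

/-- Compute the array of all excesses. -/
def excessProg (N : Net n m) (x : Fin m → ℤ) : Timed (Fin n → ℤ) := do
  let g ← tabulate fun _ => 0
  (List.finRange m).foldlM (fun g e => do
    let g ← step (Function.update g (N.tail e) (g (N.tail e) + x e))
    step (Function.update g (N.head e) (g (N.head e) - x e))) g

/-- Test the `while` condition and, if it holds, carry out one pass through the loop; the result
`none` means that the loop is left. -/
noncomputable def loopProg (search : Search) (N : Net n m) (θ : Fin m → ℝ → ℝ)
    (st : SSPState n m) : Timed (Option (SSPState n m)) := do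
  let g ← excessProg N st.x
  match ← findNode fun i => 0 < g i with
  | none => step none
  | some s =>
    match ← findNode fun i => g i < 0 with
    | none => step none
    | some t =>
      let tl ← tabulate (residualNet N).tail
      let hd ← tabulate (residualNet N).head
      let c ← tabulate (reducedCost N θ st.x st.pot)
      let r ← search n (m + m) ⟨tl, hd⟩ c s t
      let x ← r.path.foldlM (fun x a => step (push x a)) st.x
      let pot ← tabulate fun v => st.pot v - r.dist v
      step (some ⟨x, pot⟩)

/-- Semantics of a `while` loop with the given body: `LoopRuns body st st' k T` says that the loop,
started in `st`, terminates in `st'` after `k` passes and `T` steps. -/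
inductive LoopRuns {σ : Type} (body : σ → Timed (Option σ)) : σ → σ → ℕ → ℕ → Prop
  | halt (st : σ) : (body st).val = none → LoopRuns body st st 0 (body st).steps
  | next {st st' st'' : σ} {k T : ℕ} : (body st).val = some st' → LoopRuns body st' st'' k T →
      LoopRuns body st st'' (k + 1) ((body st).steps + T)

/-- Initialisation: `x` is set to `xs`, where the minimiser of a single `θ_e` is found in one step
(for `θ_e(x) = (d_e + x)²` this is a rounding of `-d_e`), and the potential is set to zero. -/
noncomputable def initProg (xs : Fin m → ℤ) : Timed (SSPState n m) := do
  let x ← tabulate xs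
  let pot ← tabulate fun _ => (0 : ℝ)
  pure ⟨x, pot⟩

/-- The successive shortest path program with starting vector `xs` terminates in state `st` after
`k` shortest path searches and `T` steps in total. -/
def SSPTerminates (search : Search) (N : Net n m) (θ : Fin m → ℝ → ℝ) (xs : Fin m → ℤ)
    (st : SSPState n m) (k T : ℕ) : Prop :=
  ∃ T₀, LoopRuns (loopProg search N θ) (initProg xs).val st k T₀ ∧
    T = (initProg (n := n) xs).steps + T₀

/-- Bellman–Ford labels: a distance together with a (reversed) path that realises it. -/
abbrev Labels (n m : ℕ) : Type := Fin n → Option (ℝ × List (Fin m))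

noncomputable def relax (N : Net n m) (w : Fin m → ℝ) (lab : Labels n m) (a : Fin m) :
    Labels n m :=
  match lab (N.tail a), lab (N.head a) with
  | none, _ => lab
  | some (du, pu), none => Function.update lab (N.head a) (some (du + w a, a :: pu))
  | some (du, pu), some (dv, _) =>
    if du + w a < dv then Function.update lab (N.head a) (some (du + w a, a :: pu)) else lab

/-- The Bellman–Ford shortest path search. -/
noncomputable def bellmanFord : Search := fun n m N w s t => do
  let lab ← tabulate fun v => if v = s then some ((0 : ℝ), ([] : List (Fin m))) else none
  let lab ← (List.range n).foldlM (fun lab _ => do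
    let lab ← (List.finRange m).foldlM (fun lab a => step (relax N w lab a)) lab
    step lab) lab
  let dist ← tabulate fun v => ((lab v).map Prod.fst).getD 0
  let rev ← step (((lab t).map Prod.snd).getD [])
  let path ← rev.foldlM (fun l a => step (a :: l)) []
  pure ⟨dist, path⟩

end Programs

/-! ## Planar graphs, their duals, and the solid-on-solid model -/

section Planar

variable {v m : ℕ}

/-- A dart is an edge with a direction: `(e, true)` leaves the tail of `e`, and `(e, false)` leaves
its head. -/
def dartNode (D : Net v m) : Fin m × Bool → Fin v
  | (e, true) => D.tail e
  | (e, false) => D.head e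

def dartRev (a : Fin m × Bool) : Fin m × Bool := (a.1, !a.2)

/-- The graph with nodes `Fin f` in which edge `e` joins the face beside `(e, true)` to the face
beside `(e, false)`. -/
def dualNet {f : ℕ} (face : Fin m × Bool → Fin f) : Net f m where
  tail e := face (e, true)
  head e := face (e, false)

/-- An embedding of `D` in the plane with `f` faces, given combinatorially: the cyclic order of the
darts around every node, and for every dart the face on its (say) left-hand side, which is
constant along facial walks. The dual graph is connected, and Euler's formula holds. `D` itself may
be disconnected, in which case several facial walks can bound the same face. -/
structure PlaneEmbedding (D : Net v m) (f : ℕ) where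
  rot : Equiv.Perm (Fin m × Bool)
  rot_sameCycle : ∀ a b, rot.SameCycle a b ↔ dartNode D a = dartNode D b
  face : Fin m × Bool → Fin f
  face_next : ∀ a, face (rot (dartRev a)) = face a
  dual_connected : (dualNet face).Connected
  euler : v + f = m + D.numComponents + 1

/-- The dual graph `D*`, with the same edge set as `D`. -/
def PlaneEmbedding.dual {D : Net v m} {f : ℕ} (P : PlaneEmbedding D f) : Net f m :=
  dualNet P.face

/-- `x_e = h_i - h_j` for all edges `e = (i, j)`. -/
def IsPotentialDifference (D : Net v m) (x : Fin m → ℤ) (h : Fin v → ℤ) : Prop :=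
  ∀ e, x e = h (D.tail e) - h (D.head e)

/-- The energy `∑ θ_e(h_i - h_j)` of a surface. -/
noncomputable def surfaceEnergy (D : Net v m) (θ : Fin m → ℝ → ℝ) (h : Fin v → ℤ) : ℝ :=
  ∑ e, θ e (h (D.tail e) - h (D.head e))

/-- The energy of the disordered solid-on-solid model with offsets `d`. -/
noncomputable def sosEnergy (D : Net v m) (d : Fin v → ℝ) (h : Fin v → ℤ) : ℝ :=
  ∑ e, ((d (D.tail e) + h (D.tail e)) - (d (D.head e) + h (D.head e))) ^ 2

/-- The edge functions `θ_e(x) = (d_e + x)²` with `d_e = d_i - d_j` for `e = (i, j)`. -/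
noncomputable def sosTheta (D : Net v m) (d : Fin v → ℝ) (e : Fin m) (x : ℝ) : ℝ :=
  ((d (D.tail e) - d (D.head e)) + x) ^ 2

end Planar

/-! ## Step counts -/

section StepCounts

/-! The algorithm is correct by linear programming duality. If all reduced costs are nonnegative,
the potential difference across each edge is a slope supporting `θ e` at `x e` on the integers. The
sum of these linear bounds vanishes on circulations, so a dual feasible circulation is optimal
(`DualFeasible.isOptimal`). With zero potential, dual feasibility is implied by termwise minimality.
Subtracting the distances from the potential keeps the reduced costs nonnegative and makes them zero
on shortest paths (`IsShortestPath.weight_eq_zero`); pushing along arcs of cost zero then preserves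
feasibility by convexity (`DualFeasible.push`). Each augmentation moves one unit of excess from a
surplus node to a deficit node, so `G` drops by exactly one. If the real minimisers form a
circulation, integer minimisers are within 1 of them, so every edge adds at most 1 to `G`
(`totalExcess_le`).

For planar graphs, rotating darts around faces shows that differences `h i - h j` are dual
circulations. Rank-nullity and Euler's formula give the converse over the reals
(`PlaneEmbedding.range_coboundary`), and rounding down makes `h` integral. In the SOS model the real
minimisers are themselves such differences.

A pass costs one search plus linear work. Bellman–Ford is verified with labels that store whole
paths; strict improvement keeps these paths simple even when zero-weight cycles exist. -/

@[simp] theorem Timed.val_bind {α β : Type} (c : Timed α) (f : α → Timed β) :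
    (c >>= f).val = (f c.val).val := rfl

@[simp] theorem Timed.steps_bind {α β : Type} (c : Timed α) (f : α → Timed β) :
    (c >>= f).steps = c.steps + (f c.val).steps := rfl

@[simp] theorem Timed.val_pure {α : Type} (a : α) : (pure a : Timed α).val = a := rfl

@[simp] theorem Timed.steps_pure {α : Type} (a : α) : (pure a : Timed α).steps = 0 := rfl

@[simp] theorem val_step {α : Type} (a : α) : (step a).val = a := rfl

@[simp] theorem steps_step {α : Type} (a : α) : (step a).steps = 1 := rfl

@[simp] theorem val_tabulate {α : Type} {k : ℕ} (f : Fin k → α) : (tabulate f).val = f := rfl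

@[simp] theorem steps_tabulate {α : Type} {k : ℕ} (f : Fin k → α) : (tabulate f).steps = k := rfl

theorem val_foldlM {α σ : Type} (f : σ → α → Timed σ) (l : List α) (s : σ) :
    (l.foldlM f s).val = l.foldl (fun s a => (f s a).val) s := by
  induction l generalizing s with
  | nil => rfl
  | cons a l ih => simp [ih]

theorem steps_foldlM {α σ : Type} (f : σ → α → Timed σ) {c : ℕ} (hf : ∀ s a, (f s a).steps = c)
    (l : List α) (s : σ) : (l.foldlM f s).steps = l.length * c := by
  induction l generalizing s with
  | nil => simp
  | cons a l ih => simp [ih, hf]; ring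

end StepCounts

/-! ## Walks and paths -/

section Walks

variable {n m : ℕ} {N : Net n m}

theorem Net.isWalk_append {l₁ l₂ : List (Fin m)} {u w : Fin n} :
    N.IsWalk (l₁ ++ l₂) u w ↔ ∃ v, N.IsWalk l₁ u v ∧ N.IsWalk l₂ v w := by
  induction l₁ generalizing u with
  | nil => simp [Net.IsWalk]
  | cons a l ih => simp [Net.IsWalk, ih, and_assoc]

theorem Net.isWalk_concat {l : List (Fin m)} {a : Fin m} {u w : Fin n} :
    N.IsWalk (l ++ [a]) u w ↔ N.IsWalk l u (N.tail a) ∧ N.head a = w := by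
  simp [Net.isWalk_append, Net.IsWalk]

theorem Net.IsWalk.unique {l : List (Fin m)} {u v w : Fin n} (hv : N.IsWalk l u v)
    (hw : N.IsWalk l u w) : v = w := by
  induction l generalizing u with
  | nil => exact Eq.trans (Eq.symm hv) hw
  | cons a l ih => exact ih hv.2 hw.2

@[simp] theorem walkWeight_nil (w : Fin m → ℝ) : walkWeight w [] = 0 := rfl

@[simp] theorem walkWeight_cons (w : Fin m → ℝ) (a : Fin m) (l : List (Fin m)) :
    walkWeight w (a :: l) = w a + walkWeight w l := by simp [walkWeight]

@[simp] theorem walkWeight_append (w : Fin m → ℝ) (l₁ l₂ : List (Fin m)) :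
    walkWeight w (l₁ ++ l₂) = walkWeight w l₁ + walkWeight w l₂ := by simp [walkWeight]

@[simp] theorem walkWeight_reverse (w : Fin m → ℝ) (l : List (Fin m)) :
    walkWeight w l.reverse = walkWeight w l := by simp [walkWeight]

theorem walkWeight_nonneg {w : Fin m → ℝ} (hw : ∀ a, 0 ≤ w a) (l : List (Fin m)) :
    0 ≤ walkWeight w l :=
  List.sum_nonneg (by simpa using fun a _ => hw a)

theorem Net.IsPath.exists_suffix {l : List (Fin m)} {u v x : Fin n} (h : N.IsPath l u v)
    (hx : x ∈ u :: l.map N.head) : ∃ l', l' <:+ l ∧ N.IsPath l' x v := by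
  induction l generalizing u with
  | nil =>
    obtain rfl : x = u := by simpa using hx
    exact ⟨[], List.suffix_rfl, h⟩
  | cons a l ih =>
    rcases List.mem_cons.1 hx with rfl | hx
    · exact ⟨_, List.suffix_rfl, h⟩
    · obtain ⟨l', hl', hp⟩ := ih ⟨h.1.2, (List.nodup_cons.1 h.2).2⟩ hx
      exact ⟨l', hl'.trans (List.suffix_cons a l), hp⟩

/-- If the new first node already lies on the path, the path is cut back to start there; the
discarded arcs have nonnegative weight. -/
theorem Net.IsWalk.exists_isPath {w : Fin m → ℝ} (hw : ∀ a, 0 ≤ w a) {l : List (Fin m)}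
    {u v : Fin n} (h : N.IsWalk l u v) :
    ∃ l', N.IsPath l' u v ∧ walkWeight w l' ≤ walkWeight w l := by
  induction l generalizing u with
  | nil => exact ⟨[], ⟨h, by simp⟩, le_rfl⟩
  | cons a l ih =>
    obtain ⟨l', hp, hle⟩ := ih h.2
    have ha := hw a
    by_cases hu : u ∈ N.head a :: l'.map N.head
    · obtain ⟨l'', ⟨r, rfl⟩, hp'⟩ := hp.exists_suffix hu
      have hr := walkWeight_nonneg hw r
      refine ⟨l'', hp', ?_⟩
      simp only [walkWeight_cons, walkWeight_append] at hle ⊢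
      linarith
    · exact ⟨a :: l', ⟨⟨h.1, hp.1⟩, List.nodup_cons.2 ⟨hu, hp.2⟩⟩, by simpa using hle⟩

theorem Net.IsPath.length_lt {l : List (Fin m)} {u v : Fin n} (h : N.IsPath l u v) :
    l.length < n := by
  have := h.2.length_le_card
  simpa [Nat.succ_le_iff] using this

end Walks

/-! ## The Bellman–Ford search -/

section BellmanFord

variable {n m : ℕ} {N : Net n m} {w : Fin m → ℝ} {s : Fin n}

/-- The label of `v` is present and at most `c`. -/
def LabelLE (lab : Labels n m) (v : Fin n) (c : ℝ) : Prop :=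
  ∃ d p, lab v = some (d, p) ∧ d ≤ c

theorem LabelLE.mono {lab : Labels n m} {v : Fin n} {c c' : ℝ} (h : LabelLE lab v c)
    (hc : c ≤ c') : LabelLE lab v c' :=
  let ⟨d, p, h₁, h₂⟩ := h
  ⟨d, p, h₁, h₂.trans hc⟩

/-- Every label belongs to a simple path from `s`, no initial part of which is lighter than the
label of the node where it ends. -/
structure ValidLabels (N : Net n m) (w : Fin m → ℝ) (s : Fin n) (lab : Labels n m) : Prop where
  path : ∀ {v d p}, lab v = some (d, p) → N.IsPath p.reverse s v
  weight : ∀ {v d p}, lab v = some (d, p) → walkWeight w p = d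
  suffix : ∀ {v d p}, lab v = some (d, p) → ∀ q, q <:+ p → ∀ u, N.IsWalk q.reverse s u →
    LabelLE lab u (walkWeight w q)

/-- A relaxation step either changes nothing or improves the label of the head of the arc. -/
theorem relax_cases (N : Net n m) (w : Fin m → ℝ) (lab : Labels n m) (a : Fin m) :
    (relax N w lab a = lab ∧
      ∀ du pu, lab (N.tail a) = some (du, pu) → LabelLE lab (N.head a) (du + w a)) ∨
    ∃ du pu, lab (N.tail a) = some (du, pu) ∧ (∀ c, LabelLE lab (N.head a) c → du + w a < c) ∧
      relax N w lab a = Function.update lab (N.head a) (some (du + w a, a :: pu)) := by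
  unfold relax
  rcases hu : lab (N.tail a) with _ | ⟨du, pu⟩
  · left; simp
  · rcases hv : lab (N.head a) with _ | ⟨dv, pv⟩
    · right
      exact ⟨du, pu, rfl, by simp [LabelLE, hv], rfl⟩
    · by_cases h : du + w a < dv
      · right
        refine ⟨du, pu, rfl, ?_, by simp [h]⟩
        rintro c ⟨d, p, hd, hc⟩
        rw [hv] at hd
        cases hd
        exact h.trans_le hc
      · left
        refine ⟨by simp [h], ?_⟩
        rintro _ _ ⟨⟩
        exact ⟨dv, pv, hv, not_lt.1 h⟩

theorem LabelLE.relax {lab : Labels n m} {v : Fin n} {c : ℝ} (h : LabelLE lab v c) (a : Fin m) :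
    LabelLE (relax N w lab a) v c := by
  rcases relax_cases N w lab a with ⟨h', -⟩ | ⟨du, pu, -, hlt, h'⟩
  · rwa [h']
  · rw [h']
    by_cases hv : v = N.head a
    · subst hv
      exact ⟨_, _, Function.update_self .., (hlt c h).le⟩
    · simpa [LabelLE, Function.update_of_ne hv] using h

theorem LabelLE.relax_head {lab : Labels n m} {a : Fin m} {c : ℝ}
    (h : LabelLE lab (N.tail a) c) : LabelLE (_root_.relax N w lab a) (N.head a) (c + w a) := by
  obtain ⟨d, p, hd, hc⟩ := h
  rcases relax_cases N w lab a with ⟨h', hle⟩ | ⟨du, pu, hdu, -, h'⟩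
  · rw [h']
    exact (hle d p hd).mono (by linarith)
  · rw [h']
    rw [hd] at hdu
    cases hdu
    exact ⟨_, _, Function.update_self .., by linarith⟩

/-- Invariant of the search. The `suffix` field is only an inequality because labels of earlier
nodes may have improved since a path was stored. -/
theorem ValidLabels.relax (hw : ∀ a, 0 ≤ w a) {lab : Labels n m} (h : ValidLabels N w s lab)
    (a : Fin m) : ValidLabels N w s (relax N w lab a) := by
  rcases relax_cases N w lab a with ⟨h', -⟩ | ⟨du, pu, hu, hlt, h'⟩
  · rwa [h']
  have key : ∀ {v d p}, _root_.relax N w lab a v = some (d, p) →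
      (v = N.head a ∧ d = du + w a ∧ p = a :: pu) ∨ lab v = some (d, p) := by
    intro v d p hv
    rw [h'] at hv
    by_cases hva : v = N.head a
    · subst hva
      rw [Function.update_self] at hv
      cases hv
      exact Or.inl ⟨rfl, rfl, rfl⟩
    · rw [Function.update_of_ne hva] at hv
      exact Or.inr hv
  have hwalk : N.IsWalk (a :: pu).reverse s (N.head a) := by
    rw [List.reverse_cons, Net.isWalk_concat]
    exact ⟨(h.path hu).1, rfl⟩
  constructor
  · intro v d p hv
    rcases key hv with ⟨rfl, rfl, rfl⟩ | hv
    · refine ⟨hwalk, ?_⟩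
      -- If the stored path already visited `N.head a`, the label there would be at most the weight
      -- of that initial part, hence at most `du`, and the arc could not strictly improve it.
      have hnew : N.head a ∉ s :: pu.reverse.map N.head := by
        intro hmem
        have : ∃ q, q <:+ pu ∧ N.IsWalk q.reverse s (N.head a) := by
          rcases List.mem_cons.1 hmem with hs | hmem
          · exact ⟨[], List.nil_suffix, hs.symm⟩
          · obtain ⟨b, hb, hba⟩ := List.mem_map.1 hmem
            obtain ⟨r, q, rfl⟩ := List.append_of_mem (List.mem_reverse.1 hb)
            refine ⟨b :: q, ⟨r, rfl⟩, ?_⟩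
            have hp := (h.path hu).1
            rw [List.reverse_append, List.reverse_cons, Net.isWalk_append] at hp
            obtain ⟨x, hx, -⟩ := hp
            rw [List.reverse_cons, Net.isWalk_concat]
            exact ⟨(Net.isWalk_concat.1 hx).1, hba⟩
        obtain ⟨q, hq, hqw⟩ := this
        have h₁ := hlt _ (h.suffix hu q hq _ hqw)
        obtain ⟨r, rfl⟩ := hq
        have h₂ := h.weight hu
        have h₃ := walkWeight_nonneg hw r
        rw [walkWeight_append] at h₂
        have := hw a
        linarith
      have hnd := (h.path hu).2
      rw [List.reverse_cons, List.map_append, ← List.cons_append, List.nodup_append]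
      refine ⟨hnd, by simp, ?_⟩
      rintro x hx y hy rfl
      obtain rfl : x = N.head a := by simpa using hy
      exact hnew hx
    · exact h.path hv
  · intro v d p hv
    rcases key hv with ⟨rfl, rfl, rfl⟩ | hv
    · rw [walkWeight_cons, h.weight hu, add_comm]
    · exact h.weight hv
  · intro v d p hv q hq u hqu
    rcases key hv with ⟨rfl, rfl, rfl⟩ | hv'
    · rcases List.suffix_cons_iff.1 hq with rfl | hq
      · obtain rfl := hqu.unique hwalk
        exact ⟨_, _, hv, by rw [walkWeight_cons, h.weight hu, add_comm]⟩
      · exact (h.suffix hu q hq u hqu).relax a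
    · exact (h.suffix hv' q hq u hqu).relax a

theorem ValidLabels.foldl_relax (hw : ∀ a, 0 ≤ w a) (l : List (Fin m)) {lab : Labels n m}
    (h : ValidLabels N w s lab) : ValidLabels N w s (l.foldl (_root_.relax N w) lab) := by
  induction l generalizing lab with
  | nil => exact h
  | cons a l ih => exact ih (h.relax hw a)

theorem LabelLE.foldl_relax (l : List (Fin m)) {lab : Labels n m} {v : Fin n} {c : ℝ}
    (h : LabelLE lab v c) : LabelLE (l.foldl (_root_.relax N w) lab) v c := by
  induction l generalizing lab with
  | nil => exact h
  | cons a l ih => exact ih (h.relax a)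

theorem LabelLE.foldl_relax_head (l : List (Fin m)) {lab : Labels n m} {a : Fin m} (ha : a ∈ l)
    {c : ℝ} (h : LabelLE lab (N.tail a) c) :
    LabelLE (l.foldl (_root_.relax N w) lab) (N.head a) (c + w a) := by
  obtain ⟨l₁, l₂, rfl⟩ := List.append_of_mem ha
  rw [List.foldl_append, List.foldl_cons]
  exact ((h.foldl_relax l₁).relax_head).foldl_relax l₂

/-- The labels after `k` rounds. -/
noncomputable def roundLabels (N : Net n m) (w : Fin m → ℝ) (s : Fin n) (k : ℕ) : Labels n m :=
  (List.range k).foldl (fun lab _ => (List.finRange m).foldl (relax N w) lab)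
    fun v => if v = s then some (0, []) else none

theorem roundLabels_succ (N : Net n m) (w : Fin m → ℝ) (s : Fin n) (k : ℕ) :
    roundLabels N w s (k + 1) = (List.finRange m).foldl (relax N w) (roundLabels N w s k) := by
  simp [roundLabels, List.range_succ]

theorem validLabels_roundLabels (hw : ∀ a, 0 ≤ w a) (k : ℕ) :
    ValidLabels N w s (roundLabels N w s k) := by
  induction k with
  | zero =>
    have key : ∀ {v d p}, roundLabels N w s 0 v = some (d, p) → v = s ∧ d = 0 ∧ p = [] := by
      intro v d p h
      by_cases hv : v = s <;> simp_all [roundLabels]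
    constructor
    · intro v d p h
      obtain ⟨rfl, rfl, rfl⟩ := key h
      exact ⟨rfl, by simp⟩
    · intro v d p h
      obtain ⟨rfl, rfl, rfl⟩ := key h
      rfl
    · intro v d p h q hq u hu
      obtain ⟨rfl, rfl, rfl⟩ := key h
      obtain rfl := List.suffix_nil.1 hq
      obtain rfl : v = u := hu
      exact ⟨_, _, h, le_rfl⟩
  | succ k ih => rw [roundLabels_succ]; exact ih.foldl_relax hw _

/-- Induction on the rounds, splitting off the last arc: the label of its tail is already good
enough, only decreases during the round, and the arc is relaxed at some point of it. -/
theorem labelLE_roundLabels (l : List (Fin m)) {v : Fin n} {k : ℕ} (h : N.IsWalk l s v)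
    (hk : l.length ≤ k) : LabelLE (roundLabels N w s k) v (walkWeight w l) := by
  induction k generalizing l v with
  | zero =>
    obtain rfl : l = [] := by simpa using hk
    obtain rfl : s = v := h
    exact ⟨0, [], by simp [roundLabels], le_rfl⟩
  | succ k ih =>
    rw [roundLabels_succ]
    rcases l.eq_nil_or_concat' with rfl | ⟨l', a, rfl⟩
    · exact (ih [] h (Nat.zero_le _)).foldl_relax _
    · obtain ⟨h₁, rfl⟩ := Net.isWalk_concat.1 h
      have := (ih l' h₁ (by simpa using hk)).foldl_relax_head (w := w) _ (List.mem_finRange a)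
      simpa using this

/-- After `n` rounds the labels are the distances. -/
theorem roundLabels_correct (hw : ∀ a, 0 ≤ w a) {v : Fin n} (hv : ∃ l, N.IsWalk l s v) :
    ∃ d p, roundLabels N w s n v = some (d, p) ∧ IsDistance N w s v d ∧
      IsShortestPath N w s v p.reverse := by
  have hle : ∀ l, N.IsWalk l s v → LabelLE (roundLabels N w s n) v (walkWeight w l) := by
    intro l hl
    -- A simple path has fewer than `n` arcs, so `n` rounds cover it.
    obtain ⟨l', hp, hle⟩ := hl.exists_isPath hw
    exact (labelLE_roundLabels l' hp.1 hp.length_lt.le).mono hle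
  obtain ⟨l, hl⟩ := hv
  obtain ⟨d, p, hd, -⟩ := hle l hl
  have hval := validLabels_roundLabels (N := N) (s := s) hw n
  have hdist : IsDistance N w s v d := by
    refine ⟨⟨p.reverse, (hval.path hd).1, by simpa using hval.weight hd⟩, fun l hl => ?_⟩
    obtain ⟨d', p', hd', hc⟩ := hle l hl
    rw [hd] at hd'
    cases hd'
    exact hc
  refine ⟨d, p, hd, hdist, hval.path hd, ?_⟩
  rwa [walkWeight_reverse, hval.weight hd]

theorem bellmanFord_dist (N : Net n m) (w : Fin m → ℝ) (s t : Fin n) :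
    (bellmanFord n m N w s t).val.dist =
      fun v => ((roundLabels N w s n v).map Prod.fst).getD 0 := by
  simp [bellmanFord, val_foldlM, roundLabels]

theorem bellmanFord_path (N : Net n m) (w : Fin m → ℝ) (s t : Fin n) :
    (bellmanFord n m N w s t).val.path =
      (((roundLabels N w s n t).map Prod.snd).getD []).reverse := by
  simp [bellmanFord, val_foldlM, roundLabels]

theorem bellmanFord_steps (N : Net n m) (w : Fin m → ℝ) (s t : Fin n) :
    (bellmanFord n m N w s t).steps =
      n + n * (m + 1) + n + 1 + (((roundLabels N w s n t).map Prod.snd).getD []).length := by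
  simp only [bellmanFord, Timed.steps_bind, Timed.val_bind, steps_tabulate, val_tabulate, steps_step,
    val_step, Timed.steps_pure, val_foldlM]
  rw [steps_foldlM (c := m + 1), steps_foldlM (c := 1)]
  · simp [roundLabels]; ring
  · simp
  · intro lab a
    rw [Timed.steps_bind, steps_foldlM (c := 1)]
    · simp
    · simp

theorem isShortestPathSearch_bellmanFord : IsShortestPathSearch bellmanFord := by
  intro n m N w s t hin
  constructor
  · intro v
    obtain ⟨d, p, h, hd, -⟩ := roundLabels_correct hin.1 (hin.2 v)
    simpa [bellmanFord_dist, h] using hd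
  · obtain ⟨d, p, h, -, hp⟩ := roundLabels_correct hin.1 (hin.2 t)
    simpa [bellmanFord_path, h] using hp

/-- `C` stays free because the sharp value 4 enters the final estimate while the main theorem uses
one common constant. -/
theorem isSearchTime_bellmanFord {C : ℕ} (hC : 4 ≤ C) :
    IsSearchTime bellmanFord fun n m => C * (n + 1) * (m + 1) := by
  intro n m
  have h4 : 4 * (n + 1) * (m + 1) ≤ C * (n + 1) * (m + 1) := by gcongr
  refine ⟨le_trans (by nlinarith) h4, fun N w s t hin => le_trans ?_ h4⟩
  obtain ⟨d, p, h, -, hp⟩ := roundLabels_correct hin.1 (hin.2 t)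
  have hlen := hp.1.length_lt
  rw [List.length_reverse] at hlen
  rw [bellmanFord_steps, h]
  simp only [Option.map_some, Option.getD_some]
  nlinarith

end BellmanFord

/-! ## Circulations -/

section Excess

variable {n m : ℕ} {N : Net n m}

theorem excess_eq_sum {R : Type} [AddCommGroup R] (N : Net n m) (x : Fin m → R) (i : Fin n) :
    excess N x i =
      ∑ e, ((if N.tail e = i then x e else 0) - (if N.head e = i then x e else 0)) := by
  simp [excess, Finset.sum_filter]

theorem excess_sub {R : Type} [AddCommGroup R] (N : Net n m) (x y : Fin m → R) (i : Fin n) :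
    excess N (x - y) i = excess N x i - excess N y i := by
  simp [excess]; abel

theorem excess_intCast (N : Net n m) (x : Fin m → ℤ) (i : Fin n) :
    excess N (fun e => (x e : ℝ)) i = (excess N x i : ℤ) := by
  simp [excess]

/-- Summation by parts. -/
theorem sum_mul_excess (N : Net n m) (x : Fin m → ℝ) (p : Fin n → ℝ) :
    ∑ i, p i * excess N x i = ∑ e, x e * (p (N.tail e) - p (N.head e)) := by
  simp only [excess_eq_sum, Finset.mul_sum]
  rw [Finset.sum_comm]
  refine Finset.sum_congr rfl fun e _ => ?_
  simp [mul_sub, mul_comm]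

theorem sum_excess (N : Net n m) (x : Fin m → ℤ) : ∑ i, excess N x i = 0 := by
  have h := sum_mul_excess N (fun e => (x e : ℝ)) fun _ => 1
  simp only [excess_intCast, one_mul, sub_self, mul_zero, Finset.sum_const_zero] at h
  exact_mod_cast h

/-- The total excess, as a natural number. -/
def posExcess (N : Net n m) (x : Fin m → ℤ) : ℕ := ∑ i, (excess N x i).toNat

/-- The excesses sum to zero, so half the sum of absolute values equals the sum of positive parts.
The integer form makes `G` a termination measure. -/
theorem totalExcess_eq (N : Net n m) (x : Fin m → ℤ) : totalExcess N x = posExcess N x := by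
  have h : ∀ z : ℤ, |(z : ℝ)| = 2 * (z.toNat : ℝ) - z := by
    intro z
    rcases le_total 0 z with hz | hz
    · have h₁ : ((z.toNat : ℤ) : ℝ) = z := by rw [Int.toNat_of_nonneg hz]
      rw [Int.cast_natCast] at h₁
      rw [h₁, abs_of_nonneg (by exact_mod_cast hz)]
      ring
    · rw [Int.toNat_of_nonpos hz, abs_of_nonpos (by exact_mod_cast hz)]
      simp
  have h₀ : ∑ i, ((excess N x i : ℤ) : ℝ) = 0 := by exact_mod_cast sum_excess N x
  simp only [totalExcess, posExcess, h, Finset.sum_sub_distrib, h₀, ← Finset.mul_sum]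
  push_cast
  ring

theorem exists_excess_neg {x : Fin m → ℤ} {s : Fin n} (hs : 0 < excess N x s) :
    ∃ t, excess N x t < 0 := by
  by_contra! h
  have := (Finset.sum_eq_zero_iff_of_nonneg fun i _ => h i).1 (sum_excess N x) s (Finset.mem_univ s)
  omega

theorem halted_iff {st : SSPState n m} : Halted N st ↔ posExcess N st.x = 0 := by
  simp [Halted, posExcess, Finset.sum_eq_zero_iff]

theorem Halted.isCirculation {st : SSPState n m} (h : Halted N st) : IsCirculation N st.x := by
  simp only [Halted, not_exists, not_lt] at h
  intro i
  exact (Finset.sum_eq_zero_iff_of_nonpos fun i _ => h i).1 (sum_excess N st.x) i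
    (Finset.mem_univ i)

theorem push_castAdd (x : Fin m → ℤ) (e : Fin m) :
    push x (Fin.castAdd m e) = Function.update x e (x e + 1) := by
  simp [push]

theorem push_natAdd (x : Fin m → ℤ) (e : Fin m) :
    push x (Fin.natAdd m e) = Function.update x e (x e - 1) :=
  Fin.addCases_right ..

theorem excess_update (N : Net n m) (x : Fin m → ℤ) (e : Fin m) (c : ℤ) (i : Fin n) :
    excess N (Function.update x e (x e + c)) i =
      excess N x i + (if N.tail e = i then c else 0) - (if N.head e = i then c else 0) := by
  have h : Function.update x e (x e + c) = x + Pi.single e c := by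
    ext a
    by_cases ha : a = e
    · subst ha; simp
    · simp [ha]
  have hs : ∀ q : Fin m → Fin n,
      (∑ a with q a = i, (Pi.single e c : Fin m → ℤ) a) = if q e = i then c else 0 := by
    intro q
    simp [Pi.single_apply]
  rw [h]
  simp only [excess, Pi.add_apply, Finset.sum_add_distrib, hs]
  ring

theorem excess_push (N : Net n m) (x : Fin m → ℤ) (a : Fin (m + m)) (i : Fin n) :
    excess N (push x a) i = excess N x i + (if (residualNet N).head a = i then 1 else 0) -
      (if (residualNet N).tail a = i then 1 else 0) := by
  refine Fin.addCases (fun e => ?_) (fun e => ?_) a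
  · simp only [push_castAdd, excess_update, residualNet, Fin.addCases_left]
  · simp only [push_natAdd, sub_eq_add_neg, excess_update, residualNet, Fin.addCases_right]
    split_ifs <;> ring

/-- Contributions at inner nodes telescope: a residual walk carries one unit of excess from its
start to its end. -/
theorem excess_augment {l : List (Fin (m + m))} {u v : Fin n} (h : (residualNet N).IsWalk l u v)
    (x : Fin m → ℤ) (i : Fin n) :
    excess N (augment x l) i =
      excess N x i + (if v = i then 1 else 0) - (if u = i then 1 else 0) := by
  induction l generalizing u x with
  | nil =>
    obtain rfl : u = v := h
    simp [augment]
  | cons a l ih =>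
    obtain ⟨rfl, h⟩ := h
    rw [augment, List.foldl_cons, ← augment, ih h, excess_push]
    ring

/-- The positive part at `s` loses one; at `t` it stays zero because the negative integer there
rises by only one. -/
theorem posExcess_augment {l : List (Fin (m + m))} {s t : Fin n} {x : Fin m → ℤ}
    (h : (residualNet N).IsWalk l s t) (hs : 0 < excess N x s) (ht : excess N x t < 0) :
    posExcess N (augment x l) + 1 = posExcess N x := by
  have hst : s ≠ t := by rintro rfl; omega
  have h₁ : ∀ i, (excess N (augment x l) i).toNat + (if s = i then 1 else 0) =
      (excess N x i).toNat := by
    intro i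
    rw [excess_augment h]
    by_cases h₁ : s = i
    · subst h₁
      simp [hst.symm]
      omega
    · by_cases h₂ : t = i
      · subst h₂
        simp [h₁]
        omega
      · simp [h₁, h₂]
  have h₂ : ∑ i : Fin n, (if s = i then 1 else 0) = 1 := by simp
  rw [posExcess, posExcess, ← Finset.sum_congr rfl fun i _ => h₁ i, Finset.sum_add_distrib, h₂]

end Excess

/-! ## Convex functions -/

section Convex

variable {f : ℝ → ℝ}

/-- `x + σ` is the convex combination of `x` and `x + t * σ` with weights `1 - t⁻¹` and `t⁻¹`. The
sign of `σ` is free, so both directions along an edge are covered. -/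
theorem ConvexOn.mul_sub_le (hf : ConvexOn ℝ Set.univ f) (x σ : ℝ) {t : ℝ} (ht : 1 ≤ t) :
    t * (f (x + σ) - f x) ≤ f (x + t * σ) - f x := by
  have ht₀ : 0 < t := by linarith
  have h := hf.2 (Set.mem_univ x) (Set.mem_univ (x + t * σ))
    (sub_nonneg.2 (inv_le_one_of_one_le₀ ht)) (inv_nonneg.2 ht₀.le) (by ring)
  have h₁ : (1 - t⁻¹) • x + t⁻¹ • (x + t * σ) = x + σ := by
    simp only [smul_eq_mul]; field_simp; ring
  rw [h₁, smul_eq_mul, smul_eq_mul] at h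
  have h₂ := mul_le_mul_of_nonneg_left h ht₀.le
  have h₃ : t * ((1 - t⁻¹) * f x + t⁻¹ * f (x + t * σ)) = (t - 1) * f x + f (x + t * σ) := by
    field_simp
  rw [h₃] at h₂
  linarith

/-- A slope between the two unit differences at `x` bounds `f` from below at all integers. -/
theorem ConvexOn.mul_sub_le_of_unit (hf : ConvexOn ℝ Set.univ f) {x : ℤ} {p : ℝ}
    (h₁ : p ≤ f (x + 1) - f x) (h₂ : -p ≤ f (x - 1) - f x) (z : ℤ) :
    p * (z - x) ≤ f z - f x := by
  rcases lt_trichotomy z x with h | rfl | h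
  · have ht : (1 : ℝ) ≤ x - z := by exact_mod_cast (by omega : (1 : ℤ) ≤ x - z)
    have := hf.mul_sub_le x (-1) ht
    rw [show (x : ℝ) + (x - z) * -1 = z by ring, ← sub_eq_add_neg] at this
    nlinarith
  · simp
  · have ht : (1 : ℝ) ≤ z - x := by exact_mod_cast (by omega : (1 : ℤ) ≤ z - x)
    have := hf.mul_sub_le x 1 ht
    rw [show (x : ℝ) + (z - x) * 1 = z by ring] at this
    nlinarith

/-- The better of the two integers around `y` works: it lies between its other neighbour and `y`, so
convexity makes it no worse than that neighbour, and slope `p = 0` turns this local minimality into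
global minimality. -/
theorem ConvexOn.exists_int_min (hf : ConvexOn ℝ Set.univ f) {y : ℝ} (hy : IsMinOn f Set.univ y) :
    ∃ k : ℤ, ∀ z : ℤ, f k ≤ f z := by
  have hy' : ∀ z, f y ≤ f z := fun z => hy (Set.mem_univ z)
  have hmid : ∀ {a b c : ℝ}, b ∈ Set.Icc a c → f b ≤ max (f a) (f c) := fun h =>
    hf.le_max_of_mem_Icc (Set.mem_univ _) (Set.mem_univ _) h
  have hk := Int.floor_le y
  have hk' := (Int.lt_floor_add_one y).le
  rcases le_total (f ⌊y⌋) (f (⌊y⌋ + 1)) with h | h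
  · refine ⟨⌊y⌋, fun z => ?_⟩
    have h' := hmid (a := ⌊y⌋ - 1) ⟨by linarith, hk⟩
    rw [max_eq_left (hy' _)] at h'
    have := hf.mul_sub_le_of_unit (x := ⌊y⌋) (p := 0) (by linarith) (by linarith) z
    linarith
  · refine ⟨⌊y⌋ + 1, fun z => ?_⟩
    have h' := hmid (c := ⌊y⌋ + 1 + 1) ⟨hk', by linarith⟩
    rw [max_eq_right (hy' _)] at h'
    have := hf.mul_sub_le_of_unit (x := ⌊y⌋ + 1) (p := 0) (by push_cast; linarith)
      (by push_cast; rw [add_sub_cancel_right]; linarith) z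
    linarith

/-- Along a ray from its unique minimiser, `f` increases strictly, so an integer farther than 1 from
`y` is beaten by its neighbour on the side of `y`. -/
theorem ConvexOn.abs_sub_le_one (hf : ConvexOn ℝ Set.univ f) {y : ℝ}
    (hy : ∀ z, z ≠ y → f y < f z) {x : ℤ} (hx : ∀ z : ℤ, f x ≤ f z) : |(x : ℝ) - y| ≤ 1 := by
  have key : ∀ σ t : ℝ, σ ≠ 0 → 1 < t → f (y + σ) < f (y + t * σ) := by
    intro σ t hσ ht
    have h₁ := hf.mul_sub_le y σ ht.le
    have h₂ := hy (y + σ) (by simpa using hσ)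
    nlinarith
  rw [abs_le]
  constructor
  · by_contra! h
    -- Chosen so that `y + σ = x + 1` and `y + t * σ = x`.
    have h₁ := key (x + 1 - y) ((x - y) / (x + 1 - y)) (by linarith)
      (by rw [lt_div_iff_of_neg (by linarith)]; linarith)
    rw [div_mul_cancel₀ _ (by linarith : (x : ℝ) + 1 - y ≠ 0), add_sub_cancel,
      add_sub_cancel] at h₁
    have := hx (x + 1)
    push_cast at this
    linarith
  · by_contra! h
    have h₁ := key (x - 1 - y) ((x - y) / (x - 1 - y)) (by linarith)
      (by rw [lt_div_iff₀ (by linarith)]; linarith)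
    rw [div_mul_cancel₀ _ (by linarith : (x : ℝ) - 1 - y ≠ 0), add_sub_cancel,
      add_sub_cancel] at h₁
    have := hx (x - 1)
    push_cast at this
    linarith

end Convex

/-! ## Dual feasibility -/

section Dual

variable {n m : ℕ} {N : Net n m} {θ : Fin m → ℝ → ℝ}

theorem reducedCost_castAdd (N : Net n m) (θ : Fin m → ℝ → ℝ) (x : Fin m → ℤ)
    (pot : Fin n → ℝ) (e : Fin m) : reducedCost N θ x pot (Fin.castAdd m e) =
      θ e (x e + 1) - θ e (x e) - pot (N.head e) + pot (N.tail e) :=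
  Fin.addCases_left ..

theorem reducedCost_natAdd (N : Net n m) (θ : Fin m → ℝ → ℝ) (x : Fin m → ℤ)
    (pot : Fin n → ℝ) (e : Fin m) : reducedCost N θ x pot (Fin.natAdd m e) =
      θ e (x e - 1) - θ e (x e) + pot (N.head e) - pot (N.tail e) :=
  Fin.addCases_right ..

theorem exists_isTermwiseMin (hθ : ∀ e, ConvexOn ℝ Set.univ (θ e))
    (hmin : ∀ e, ∃ y, IsMinOn (θ e) Set.univ y) : ∃ xs, IsTermwiseMin θ xs := by
  choose y hy using hmin
  choose xs hxs using fun e => (hθ e).exists_int_min (hy e)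
  exact ⟨xs, hxs⟩

theorem IsTermwiseMin.dualFeasible {x : Fin m → ℤ} (h : IsTermwiseMin θ x) :
    DualFeasible N θ x fun _ => 0 := by
  intro a
  refine Fin.addCases (fun e => ?_) (fun e => ?_) a
  · simpa [reducedCost_castAdd] using h e (x e + 1)
  · simpa [reducedCost_natAdd, -Fin.natAdd_eq_addNat] using h e (x e - 1)

/-- The two reduced costs of an edge say that its potential difference is a supporting slope;
summation by parts cancels the linear terms for both circulations. -/
theorem DualFeasible.isOptimal (hθ : ∀ e, ConvexOn ℝ Set.univ (θ e)) {x : Fin m → ℤ}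
    {pot : Fin n → ℝ} (h : DualFeasible N θ x pot) (hx : IsCirculation N x) :
    IsOptimalCirculation N θ x := by
  refine ⟨hx, fun y hy => ?_⟩
  have h₁ : ∀ e, (pot (N.head e) - pot (N.tail e)) * ((y e : ℝ) - x e) ≤
      θ e (y e) - θ e (x e) := by
    intro e
    have ha := h (Fin.castAdd m e)
    have hb := h (Fin.natAdd m e)
    rw [reducedCost_castAdd] at ha
    rw [reducedCost_natAdd] at hb
    exact (hθ e).mul_sub_le_of_unit (by linarith) (by linarith) (y e)
  have h₂ : ∀ z : Fin m → ℤ, IsCirculation N z →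
      ∑ e, (pot (N.head e) - pot (N.tail e)) * (z e : ℝ) = 0 := by
    intro z hz
    have := sum_mul_excess N (fun e => (z e : ℝ)) fun i => -pot i
    simp only [excess_intCast, hz _, Int.cast_zero, mul_zero, Finset.sum_const_zero] at this
    rw [this]
    exact Finset.sum_congr rfl fun e _ => by ring
  have h₃ := Finset.sum_le_sum fun e (_ : e ∈ Finset.univ) => h₁ e
  simp only [mul_sub, Finset.sum_sub_distrib, h₂ y hy, h₂ x hx] at h₃
  simp only [cost]
  linarith

/-! ### Reduced costs along shortest paths and preservation of dual feasibility -/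

theorem reducedCost_sub (N : Net n m) (θ : Fin m → ℝ → ℝ) (x : Fin m → ℤ) (pot d : Fin n → ℝ)
    (a : Fin (m + m)) : reducedCost N θ x (fun v => pot v - d v) a =
      reducedCost N θ x pot a + d ((residualNet N).tail a) - d ((residualNet N).head a) := by
  refine Fin.addCases (fun e => ?_) (fun e => ?_) a
  · simp only [reducedCost_castAdd, residualNet, Fin.addCases_left]
    ring
  · simp only [reducedCost_natAdd, residualNet, Fin.addCases_right]
    ring

theorem walkWeight_potential {w w' : Fin m → ℝ} {d : Fin n → ℝ}
    (hw : ∀ a, w' a = w a + d (N.tail a) - d (N.head a)) {l : List (Fin m)} {u v : Fin n}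
    (h : N.IsWalk l u v) : walkWeight w' l = walkWeight w l + d u - d v := by
  induction l generalizing u with
  | nil =>
    obtain rfl : u = v := h
    simp
  | cons a l ih =>
    obtain ⟨rfl, h⟩ := h
    rw [walkWeight_cons, walkWeight_cons, ih h, hw]
    ring

theorem IsDistance.unique {w : Fin m → ℝ} {u v : Fin n} {d d' : ℝ} (h : IsDistance N w u v d)
    (h' : IsDistance N w u v d') : d = d' := by
  obtain ⟨⟨l, hl, rfl⟩, h₁⟩ := h
  obtain ⟨⟨l', hl', rfl⟩, h₂⟩ := h'
  exact le_antisymm (h₁ _ hl') (h₂ _ hl)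

theorem IsDistance.le_add {w : Fin m → ℝ} {s : Fin n} {d : Fin n → ℝ}
    (h : ∀ v, IsDistance N w s v (d v)) (a : Fin m) : d (N.head a) ≤ d (N.tail a) + w a := by
  obtain ⟨l, hl, hd⟩ := (h (N.tail a)).1
  have := (h (N.head a)).2 (l ++ [a]) (Net.isWalk_concat.2 ⟨hl, rfl⟩)
  simpa [hd] using this

/-- The new weights are nonnegative by the triangle inequality, and along a shortest path they
telescope to total zero. -/
theorem IsShortestPath.weight_eq_zero {w w' : Fin m → ℝ} (hw : ∀ a, 0 ≤ w a) {s t : Fin n}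
    {d : Fin n → ℝ} (hd : ∀ v, IsDistance N w s v (d v)) {l : List (Fin m)}
    (hl : IsShortestPath N w s t l) (hw' : ∀ a, w' a = w a + d (N.tail a) - d (N.head a)) :
    ∀ a ∈ l, w' a = 0 := by
  have hnn : ∀ a, 0 ≤ w' a := fun a => by
    have := IsDistance.le_add hd a
    rw [hw']
    linarith
  have hs : d s = 0 :=
    (hd s).unique ⟨⟨[], rfl, rfl⟩, fun l _ => walkWeight_nonneg hw l⟩
  have hsum : walkWeight w' l = 0 := by
    rw [walkWeight_potential hw' hl.1.1, hs, (hd t).unique hl.2]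
    ring
  have : ∀ l : List (Fin m), walkWeight w' l = 0 → ∀ a ∈ l, w' a = 0 := by
    intro l
    induction l with
    | nil => simp
    | cons b l ih =>
      intro h
      rw [walkWeight_cons] at h
      have h₁ := hnn b
      have h₂ := walkWeight_nonneg hnn l
      intro a ha
      rcases List.mem_cons.1 ha with rfl | ha
      · linarith
      · exact ih (by linarith) a ha
  exact this l hsum

theorem reducedCost_update_of_ne (N : Net n m) (θ : Fin m → ℝ → ℝ) (x : Fin m → ℤ)
    (pot : Fin n → ℝ) {e e' : Fin m} (h : e' ≠ e) (c : ℤ) :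
    reducedCost N θ (Function.update x e c) pot (Fin.castAdd m e') =
      reducedCost N θ x pot (Fin.castAdd m e') ∧
    reducedCost N θ (Function.update x e c) pot (Fin.natAdd m e') =
      reducedCost N θ x pot (Fin.natAdd m e') := by
  simp only [reducedCost_castAdd, reducedCost_natAdd, Function.update_of_ne h, and_self]

/-- By convexity a second step along `a` costs at least as much as the first, which was free, and
the reverse arc gets the opposite cost, again zero. Other edges are untouched. The second conclusion
lets the remaining arcs of a path be pushed in turn; `a` itself may lose cost zero, so arcs must not
repeat. -/
theorem DualFeasible.push (hθ : ∀ e, ConvexOn ℝ Set.univ (θ e)) {x : Fin m → ℤ} {pot : Fin n → ℝ}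
    (h : DualFeasible N θ x pot) {a : Fin (m + m)} (ha : reducedCost N θ x pot a = 0) :
    DualFeasible N θ (_root_.push x a) pot ∧
      ∀ b, b ≠ a → reducedCost N θ x pot b = 0 → reducedCost N θ (_root_.push x a) pot b = 0 := by
  induction a using Fin.addCases with
  | left e =>
    rw [reducedCost_castAdd] at ha
    have hc := (hθ e).mul_sub_le (x e) 1 one_le_two
    have hb : reducedCost N θ (_root_.push x (Fin.castAdd m e)) pot (Fin.natAdd m e) = 0 := by
      rw [push_castAdd, reducedCost_natAdd, Function.update_self]
      push_cast
      rw [add_sub_cancel_right]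
      linarith
    constructor
    · intro b
      induction b using Fin.addCases with
      | left e' =>
        by_cases he : e' = e
        · subst he
          rw [push_castAdd, reducedCost_castAdd, Function.update_self]
          push_cast
          rw [show (x e' : ℝ) + 1 + 1 = x e' + 2 * 1 by ring]
          linarith
        · rw [push_castAdd, (reducedCost_update_of_ne N θ x pot he _).1]
          exact h _
      | right e' =>
        by_cases he : e' = e
        · subst he
          exact hb.ge
        · rw [push_castAdd, (reducedCost_update_of_ne N θ x pot he _).2]
          exact h _
    · intro b hba hb₀
      induction b using Fin.addCases with
      | left e' =>
        have he : e' ≠ e := by rintro rfl; exact hba rfl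
        rwa [push_castAdd, (reducedCost_update_of_ne N θ x pot he _).1]
      | right e' =>
        by_cases he : e' = e
        · subst he
          exact hb
        · rwa [push_castAdd, (reducedCost_update_of_ne N θ x pot he _).2]
  | right e =>
    rw [reducedCost_natAdd] at ha
    have hc := (hθ e).mul_sub_le (x e) (-1) one_le_two
    rw [← sub_eq_add_neg] at hc
    have hb : reducedCost N θ (_root_.push x (Fin.natAdd m e)) pot (Fin.castAdd m e) = 0 := by
      rw [push_natAdd, reducedCost_castAdd, Function.update_self]
      push_cast
      rw [sub_add_cancel]
      linarith
    constructor
    · intro b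
      induction b using Fin.addCases with
      | left e' =>
        by_cases he : e' = e
        · subst he
          exact hb.ge
        · rw [push_natAdd, (reducedCost_update_of_ne N θ x pot he _).1]
          exact h _
      | right e' =>
        by_cases he : e' = e
        · subst he
          rw [push_natAdd, reducedCost_natAdd, Function.update_self]
          push_cast
          rw [show (x e' : ℝ) - 1 - 1 = x e' + 2 * -1 by ring]
          linarith
        · rw [push_natAdd, (reducedCost_update_of_ne N θ x pot he _).2]
          exact h _
    · intro b hba hb₀
      induction b using Fin.addCases with
      | left e' =>
        by_cases he : e' = e
        · subst he
          exact hb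
        · rwa [push_natAdd, (reducedCost_update_of_ne N θ x pot he _).1]
      | right e' =>
        have he : e' ≠ e := by rintro rfl; exact hba rfl
        rwa [push_natAdd, (reducedCost_update_of_ne N θ x pot he _).2]

theorem DualFeasible.augment (hθ : ∀ e, ConvexOn ℝ Set.univ (θ e)) {x : Fin m → ℤ}
    {pot : Fin n → ℝ} (h : DualFeasible N θ x pot) {l : List (Fin (m + m))} (hl : l.Nodup)
    (h₀ : ∀ a ∈ l, reducedCost N θ x pot a = 0) : DualFeasible N θ (_root_.augment x l) pot := by
  induction l generalizing x with
  | nil => exact h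
  | cons a l ih =>
    obtain ⟨hal, hl⟩ := List.nodup_cons.1 hl
    obtain ⟨h₁, h₂⟩ := h.push hθ (h₀ a (by simp))
    exact ih h₁ hl fun b hb => h₂ b (by rintro rfl; exact hal hb) (h₀ b (by simp [hb]))

theorem DualFeasible.iteration (hθ : ∀ e, ConvexOn ℝ Set.univ (θ e)) {st st' : SSPState n m}
    (h : DualFeasible N θ st.x st.pot) (hit : Iteration N θ st st') :
    DualFeasible N θ st'.x st'.pot ∧ posExcess N st'.x + 1 = posExcess N st.x := by
  obtain ⟨s, t, d, l, hs, ht, hd, hl, rfl⟩ := hit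
  have hw := fun a => reducedCost_sub N θ st.x st.pot d a
  refine ⟨DualFeasible.augment hθ (fun a => ?_) ?_ ?_, posExcess_augment hl.1.1 hs ht⟩
  · have := IsDistance.le_add hd a
    rw [hw]
    linarith
  -- Distinct heads force distinct arcs.
  · exact (List.nodup_cons.1 hl.1.2).2.of_map
  · exact hl.weight_eq_zero h hd hw

theorem Run.dualFeasible (hθ : ∀ e, ConvexOn ℝ Set.univ (θ e)) {st st' : SSPState n m} {k : ℕ}
    (h : DualFeasible N θ st.x st.pot) (hrun : Run N θ k st st') :
    DualFeasible N θ st'.x st'.pot ∧ posExcess N st'.x + k = posExcess N st.x := by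
  induction hrun with
  | refl => exact ⟨h, rfl⟩
  | tail _ hit ih =>
    obtain ⟨h₁, h₂⟩ := ih h
    obtain ⟨h₃, h₄⟩ := h₁.iteration hθ hit
    exact ⟨h₃, by omega⟩

/-- `Run` grows at its end, whereas the program's loop is unfolded from its first pass. -/
theorem Run.head {st st' st'' : SSPState n m} {k : ℕ} (hit : Iteration N θ st st')
    (hrun : Run N θ k st' st'') : Run N θ (k + 1) st st'' := by
  induction hrun with
  | refl => exact .tail (.refl _) hit
  | tail _ hit' ih => exact .tail (ih hit) hit'

theorem residualNet_reachable (hN : N.Connected) (s v : Fin n) :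
    ∃ l, (residualNet N).IsWalk l s v := by
  have hsub : Subsingleton (Quot fun u v : Fin n => ∃ e, N.tail e = u ∧ N.head e = v) :=
    (Nat.card_eq_one_iff_unique.1 hN).1
  have hgen := Quot.eqvGen_exact (hsub.elim (Quot.mk _ s) (Quot.mk _ v))
  have arc : ∀ a, ∃ l, (residualNet N).IsWalk l ((residualNet N).tail a)
      ((residualNet N).head a) := fun a => ⟨[a], rfl, rfl⟩
  -- Both directions are carried along so that the symmetric case is immediate.
  have : ∀ {u v}, Relation.EqvGen (fun u v : Fin n => ∃ e, N.tail e = u ∧ N.head e = v) u v →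
      (∃ l, (residualNet N).IsWalk l u v) ∧ ∃ l, (residualNet N).IsWalk l v u := by
    intro u v h
    induction h with
    | rel u v h =>
      obtain ⟨e, rfl, rfl⟩ := h
      exact ⟨by simpa [residualNet, -Fin.natAdd_eq_addNat] using arc (Fin.natAdd m e),
        by simpa [residualNet] using arc (Fin.castAdd m e)⟩
    | refl u => exact ⟨⟨[], rfl⟩, [], rfl⟩
    | symm _ _ _ ih => exact ih.symm
    | trans _ _ _ _ _ ih₁ ih₂ =>
      obtain ⟨⟨l₁, h₁⟩, l₁', h₁'⟩ := ih₁
      obtain ⟨⟨l₂, h₂⟩, l₂', h₂'⟩ := ih₂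
      exact ⟨⟨l₁ ++ l₂, Net.isWalk_append.2 ⟨_, h₁, h₂⟩⟩,
        l₂' ++ l₁', Net.isWalk_append.2 ⟨_, h₂', h₁'⟩⟩
  exact (this hgen).1

theorem DualFeasible.searchInput (hN : N.Connected) {x : Fin m → ℤ} {pot : Fin n → ℝ}
    (h : DualFeasible N θ x pot) (s : Fin n) :
    SearchInput (residualNet N) (reducedCost N θ x pot) s :=
  ⟨h, residualNet_reachable hN s⟩

/-- Correctness of Bellman–Ford doubles as the existence proof for distances and a shortest path. -/
theorem DualFeasible.exists_iteration (hN : N.Connected) {st : SSPState n m}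
    (h : DualFeasible N θ st.x st.pot) (hst : ¬ Halted N st) : ∃ st', Iteration N θ st st' := by
  obtain ⟨s, hs⟩ := not_not.1 hst
  obtain ⟨t, ht⟩ := exists_excess_neg hs
  have := isShortestPathSearch_bellmanFord _ _ _ _ s t (h.searchInput hN s)
  exact ⟨_, s, t, _, _, hs, ht, this.1, this.2, rfl⟩

/-- `xs - y` has the same excesses as `xs` and entries of absolute value at most 1. Each edge is
counted at its two ends, giving `2 * m` before halving. -/
theorem totalExcess_le (hθ : ∀ e, ConvexOn ℝ Set.univ (θ e)) {xs : Fin m → ℤ}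
    (hxs : IsTermwiseMin θ xs) {y : Fin m → ℝ} (hy : IsCirculation N y)
    (hmin : ∀ e z, z ≠ y e → θ e (y e) < θ e z) : totalExcess N xs ≤ m := by
  have h₁ : ∀ i, |((excess N xs i : ℤ) : ℝ)| ≤
      ∑ e, ((if N.tail e = i then 1 else 0) + (if N.head e = i then 1 else 0)) := by
    intro i
    have h : ((excess N xs i : ℤ) : ℝ) = excess N ((fun e => (xs e : ℝ)) - y) i := by
      rw [excess_sub, hy i, excess_intCast, sub_zero]
    rw [h, excess_eq_sum]
    refine (Finset.abs_sum_le_sum_abs _ _).trans (Finset.sum_le_sum fun e _ => ?_)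
    have := (hθ e).abs_sub_le_one (hmin e) (hxs e)
    refine (abs_sub _ _).trans ?_
    simp only [Pi.sub_apply]
    gcongr <;> split_ifs <;> simp [this]
  have h₂ := Finset.sum_le_sum fun i (_ : i ∈ Finset.univ) => h₁ i
  rw [Finset.sum_comm] at h₂
  simp only [Finset.sum_add_distrib, Finset.sum_ite_eq, Finset.mem_univ, if_true,
    Finset.sum_const, Finset.card_univ, Fintype.card_fin, nsmul_eq_mul, mul_one] at h₂
  rw [totalExcess]
  linarith

end Dual

/-! ## Planar duality -/

section PlanarDuality

variable {v m f : ℕ} {D : Net v m}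

theorem dartRev_dartRev (a : Fin m × Bool) : dartRev (dartRev a) = a := by
  simp [dartRev]

/-- Reversal of darts as a permutation. -/
def dartRevPerm (m : ℕ) : Equiv.Perm (Fin m × Bool) :=
  ⟨dartRev, dartRev, dartRev_dartRev, dartRev_dartRev⟩

/-- Differences of a function on the nodes form a circulation of the dual graph. -/
theorem PlaneEmbedding.isCirculation_sub (P : PlaneEmbedding D f) {R : Type} [AddCommGroup R]
    (h : Fin v → R) : IsCirculation P.dual fun e => h (D.tail e) - h (D.head e) := by
  intro i
  -- The permutation taking `a` to `P.rot (dartRev a)` moves to the next dart of the facial walk: it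
  -- keeps the face, and the new dart leaves the node where `a` ends.
  have key : ∑ a : Fin m × Bool, (if P.face a = i then h (dartNode D a) else 0) =
      ∑ a : Fin m × Bool, (if P.face a = i then h (dartNode D (dartRev a)) else 0) := by
    rw [← ((dartRevPerm m).trans P.rot).sum_comp]
    refine Finset.sum_congr rfl fun a _ => ?_
    have h₁ : P.face (P.rot (dartRev a)) = P.face a := P.face_next a
    have h₂ : dartNode D (P.rot (dartRev a)) = dartNode D (dartRev a) :=
      ((P.rot_sameCycle _ _).1 ⟨1, by simp⟩).symm
    simp only [dartRevPerm, Equiv.trans_apply, Equiv.coe_fn_mk, h₁, h₂]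
  rw [Fintype.sum_prod_type, Fintype.sum_prod_type] at key
  simp only [Fintype.sum_bool, dartNode, dartRev, Bool.not_true, Bool.not_false,
    Finset.sum_add_distrib] at key
  simp only [← Finset.sum_filter] at key
  simp only [excess, PlaneEmbedding.dual, dualNet, Finset.sum_sub_distrib]
  rw [sub_eq_zero, sub_eq_sub_iff_add_eq_add]
  exact key.trans (add_comm _ _)

/-- The coboundary map. -/
def coboundary (D : Net v m) : (Fin v → ℝ) →ₗ[ℝ] (Fin m → ℝ) where
  toFun h e := h (D.tail e) - h (D.head e)
  map_add' h h' := by ext e; simp; ring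
  map_smul' c h := by ext e; simp; ring

/-- The excess as a linear map. -/
def excessMap (D : Net v m) : (Fin m → ℝ) →ₗ[ℝ] (Fin v → ℝ) where
  toFun x i := excess D x i
  map_add' x y := by ext i; simp [excess, Finset.sum_add_distrib]; ring
  map_smul' c x := by ext i; simp [excess, ← Finset.mul_sum, mul_sub]

/-- The functions with zero coboundary are those constant on the components. -/
noncomputable def kerCoboundaryEquiv (D : Net v m) :
    (Quot (fun u w : Fin v => ∃ e, D.tail e = u ∧ D.head e = w) → ℝ) ≃ₗ[ℝ]
      LinearMap.ker (coboundary D) where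
  toFun q := ⟨fun u => q (Quot.mk _ u), by
    ext e
    have : Quot.mk (fun u w : Fin v => ∃ e, D.tail e = u ∧ D.head e = w) (D.tail e) =
      Quot.mk _ (D.head e) := Quot.sound ⟨e, rfl, rfl⟩
    simp [coboundary, this]⟩
  map_add' _ _ := rfl
  map_smul' _ _ := rfl
  invFun h := Quot.lift h.1 (by
    rintro _ _ ⟨e, rfl, rfl⟩
    exact sub_eq_zero.1 (congrFun h.2 e))
  left_inv q := by
    ext u
    induction u using Quot.ind
    rfl
  right_inv _ := rfl

theorem finrank_range_coboundary (D : Net v m) :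
    Module.finrank ℝ (LinearMap.range (coboundary D)) + D.numComponents = v := by
  have h := (coboundary D).finrank_range_add_finrank_ker
  have : Finite (Quot fun u w : Fin v => ∃ e, D.tail e = u ∧ D.head e = w) := Quot.finite _
  have := Fintype.ofFinite (Quot fun u w : Fin v => ∃ e, D.tail e = u ∧ D.head e = w)
  rw [← (kerCoboundaryEquiv D).finrank_eq, Module.finrank_fintype_fun_eq_card,
    Module.finrank_fintype_fun_eq_card, Fintype.card_fin, ← Nat.card_eq_fintype_card] at h
  exact h

theorem toMatrix_excessMap (D : Net v m) :
    LinearMap.toMatrix' (excessMap D) = (LinearMap.toMatrix' (coboundary D)).transpose := by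
  ext i e
  simp [LinearMap.toMatrix'_apply, excessMap, coboundary, excess, Pi.single_apply]

/-- The two maps are transposes of each other, so they have equal rank. -/
theorem finrank_range_excessMap (D : Net v m) :
    Module.finrank ℝ (LinearMap.range (excessMap D)) =
      Module.finrank ℝ (LinearMap.range (coboundary D)) := by
  have h := Matrix.rank_transpose (LinearMap.toMatrix' (coboundary D))
  rw [← toMatrix_excessMap, Matrix.rank, Matrix.rank, ← Matrix.toLin'_apply',
    ← Matrix.toLin'_apply', Matrix.toLin'_toMatrix', Matrix.toLin'_toMatrix'] at h
  exact h

/-- Real circulations of the dual graph are potential differences. -/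
theorem PlaneEmbedding.range_coboundary (P : PlaneEmbedding D f) :
    LinearMap.range (coboundary D) = LinearMap.ker (excessMap P.dual) := by
  refine Submodule.eq_of_le_of_finrank_eq ?_ ?_
  · rintro _ ⟨h, rfl⟩
    exact funext (P.isCirculation_sub h)
  -- The dimensions are `v - D.numComponents` and `m - (f - 1)`; Euler's formula equates them.
  · have h₁ := finrank_range_coboundary D
    have h₂ := finrank_range_coboundary P.dual
    have h₃ := (excessMap P.dual).finrank_range_add_finrank_ker
    rw [finrank_range_excessMap, Module.finrank_fintype_fun_eq_card, Fintype.card_fin] at h₃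
    have h₄ : P.dual.numComponents = 1 := P.dual_connected
    have := P.euler
    omega

theorem PlaneEmbedding.exists_isPotentialDifference (P : PlaneEmbedding D f) {x : Fin m → ℤ}
    (hx : IsCirculation P.dual x) : ∃ h, IsPotentialDifference D x h := by
  have hmem : (fun e => (x e : ℝ)) ∈ LinearMap.range (coboundary D) := by
    rw [P.range_coboundary]
    ext i
    simp [excessMap, excess_intCast, hx i]
  obtain ⟨h, hh⟩ := hmem
  -- Rounding down commutes with adding the integer `x e`, so the differences survive.
  refine ⟨fun i => ⌊h i⌋, fun e => ?_⟩
  have h₁ : h (D.tail e) = h (D.head e) + x e := by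
    have : h (D.tail e) - h (D.head e) = x e := congrFun hh e
    linarith
  simp [h₁]

/-- Every competitor `h'` yields a dual circulation of cost equal to its energy. -/
theorem PlaneEmbedding.surfaceEnergy_le (P : PlaneEmbedding D f) {θ : Fin m → ℝ → ℝ}
    {x : Fin m → ℤ} (hx : IsOptimalCirculation P.dual θ x) {h : Fin v → ℤ}
    (hh : IsPotentialDifference D x h) (h' : Fin v → ℤ) :
    surfaceEnergy D θ h ≤ surfaceEnergy D θ h' := by
  have := hx.2 _ (P.isCirculation_sub h')
  simpa [cost, surfaceEnergy, hh _] using this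

theorem sosEnergy_eq (D : Net v m) (d : Fin v → ℝ) (h : Fin v → ℤ) :
    sosEnergy D d h = surfaceEnergy D (sosTheta D d) h :=
  Finset.sum_congr rfl fun e _ => by rw [sosTheta]; ring

theorem convexOn_sosTheta (D : Net v m) (d : Fin v → ℝ) (e : Fin m) :
    ConvexOn ℝ Set.univ (sosTheta D d e) := by
  have h := (even_two.convexOn_pow (𝕜 := ℝ)).translate_right (d (D.tail e) - d (D.head e))
  rw [Set.preimage_univ] at h
  exact h

theorem PlaneEmbedding.totalExcess_sos_le (P : PlaneEmbedding D f) {d : Fin v → ℝ}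
    {xs : Fin m → ℤ} (hxs : IsTermwiseMin (sosTheta D d) xs) : totalExcess P.dual xs ≤ m := by
  -- The real minimiser on `e` is minus the offset difference, which is the coboundary of `-d` and
  -- hence a dual circulation.
  refine totalExcess_le (convexOn_sosTheta D d) hxs (P.isCirculation_sub fun i => -d i)
    fun e z hz => ?_
  have h : d (D.tail e) - d (D.head e) + z ≠ 0 := fun h => hz (by linarith)
  have := pow_pos (abs_pos.2 h) 2
  rw [sq_abs] at this
  simpa [sosTheta] using this

end PlanarDuality

/-! ## The program -/

section Program

variable {n m : ℕ} {N : Net n m} {θ : Fin m → ℝ → ℝ}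

theorem excessProg_val (N : Net n m) (x : Fin m → ℤ) : (excessProg N x).val = excess N x := by
  -- The second update reads the array left by the first, so a loop contributes zero.
  have h : ∀ (l : List (Fin m)) (g : Fin n → ℤ) (i : Fin n),
      l.foldl (fun g e => Function.update (Function.update g (N.tail e) (g (N.tail e) + x e))
        (N.head e) (Function.update g (N.tail e) (g (N.tail e) + x e) (N.head e) - x e)) g i =
      g i + (l.map fun e =>
        (if N.tail e = i then x e else 0) - (if N.head e = i then x e else 0)).sum := by
    intro l
    induction l with
    | nil => simp
    | cons e l ih =>
      intro g i
      rw [List.foldl_cons, ih, List.map_cons, List.sum_cons, ← add_assoc]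
      congr 1
      by_cases h₁ : N.head e = i <;> by_cases h₂ : N.tail e = i <;>
        simp_all [Function.update_apply, eq_comm, sub_eq_add_neg]
  ext i
  rw [excess_eq_sum, Fin.sum_univ_def]
  simp [excessProg, val_foldlM, h]

theorem excessProg_steps (N : Net n m) (x : Fin m → ℤ) :
    (excessProg N x).steps = n + m * 2 := by
  rw [excessProg, Timed.steps_bind, steps_foldlM (c := 2)]
  · simp
  · simp

theorem findNode_spec (p : Fin n → Prop) [DecidablePred p] :
    ((findNode p).val = none ∧ ∀ i, ¬ p i) ∨ ∃ i, (findNode p).val = some i ∧ p i := by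
  rcases h : (findNode p).val with _ | i
  · left
    simpa [findNode, List.find?_eq_none] using h
  · right
    exact ⟨i, rfl, by simpa using List.find?_some h⟩

theorem findNode_steps (p : Fin n → Prop) [DecidablePred p] : (findNode p).steps = n := rfl

theorem loopProg_halted (search : Search) {st : SSPState n m} (h : Halted N st) :
    (loopProg search N θ st).val = none ∧ (loopProg search N θ st).steps = 2 * n + 2 * m + 1 := by
  rcases findNode_spec fun i => 0 < excess N st.x i with ⟨h₁, -⟩ | ⟨i, -, hi⟩
  · simp only [loopProg, Timed.val_bind, Timed.steps_bind, excessProg_val, h₁, excessProg_steps,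
      findNode_steps, val_step, steps_step, true_and]
    ring
  · exact absurd ⟨i, hi⟩ h

theorem loopProg_iteration (hN : N.Connected) {search : Search} {S : ℕ → ℕ → ℕ}
    (hsearch : IsShortestPathSearch search) (hS : IsSearchTime search S) {st : SSPState n m}
    (hst : DualFeasible N θ st.x st.pot) (h : ¬ Halted N st) :
    ∃ st', (loopProg search N θ st).val = some st' ∧ Iteration N θ st st' ∧
      (loopProg search N θ st).steps ≤ 5 * n + 8 * m + 1 + S n (2 * m) := by
  rw [two_mul]
  rcases findNode_spec fun i => 0 < excess N st.x i with ⟨-, h₁⟩ | ⟨s, h₁, hs⟩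
  · exact absurd (fun ⟨i, hi⟩ => h₁ i hi) h
  rcases findNode_spec fun i => excess N st.x i < 0 with ⟨-, h₂⟩ | ⟨t, h₂, ht⟩
  · obtain ⟨t, ht⟩ := exists_excess_neg hs
    exact absurd ht (h₂ t)
  have hin := hst.searchInput hN s
  obtain ⟨hd, hp⟩ := hsearch _ _ _ _ s t hin
  have htime := (hS n (m + m)).2 _ _ s t hin
  have hlen := hp.1.length_lt
  refine ⟨_, ?_, ⟨s, t, _, _, hs, ht, hd, hp, rfl⟩, ?_⟩
  · simp only [loopProg, Timed.val_bind, excessProg_val, h₁, h₂, val_step, val_tabulate,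
      val_foldlM, augment]
  · simp only [loopProg, Timed.steps_bind, excessProg_val, excessProg_steps,
      findNode_steps, h₁, h₂, steps_step, val_tabulate, steps_tabulate]
    -- Besides the search: `n + 2m` for the excesses, `2n` for two scans, `6m` for three arc arrays,
    -- fewer than `n` pushes, `n` for the potential, and one final step.
    rw [steps_foldlM (c := 1) _ fun _ _ => rfl]
    change _ + (_ + (_ + (_ + (_ + (_ + ((search n (m + m) (residualNet N)
      (reducedCost N θ st.x st.pot) s t).steps + ((search n (m + m) (residualNet N)
      (reducedCost N θ st.x st.pot) s t).val.path.length * 1 + _))))))) ≤ _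
    omega

/-- The factor `k + 1` includes the last evaluation of the body, whose test fails. -/
theorem exists_loopRuns (hN : N.Connected) (hθ : ∀ e, ConvexOn ℝ Set.univ (θ e)) {search : Search}
    {S : ℕ → ℕ → ℕ} (hsearch : IsShortestPathSearch search) (hS : IsSearchTime search S) (k : ℕ)
    (st : SSPState n m) (hst : DualFeasible N θ st.x st.pot) (hk : posExcess N st.x = k) :
    ∃ st' T, LoopRuns (loopProg search N θ) st st' k T ∧ Run N θ k st st' ∧ Halted N st' ∧
      T ≤ (k + 1) * (5 * n + 8 * m + 1 + S n (2 * m)) := by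
  induction k generalizing st with
  | zero =>
    have hh := halted_iff.2 hk
    obtain ⟨h₁, h₂⟩ := loopProg_halted (θ := θ) search hh
    exact ⟨st, _, .halt st h₁, .refl st, hh, by rw [h₂]; omega⟩
  | succ k ih =>
    have hh : ¬ Halted N st := by rw [halted_iff]; omega
    obtain ⟨st', h₁, hit, h₂⟩ := loopProg_iteration hN hsearch hS hst hh
    obtain ⟨h₃, h₄⟩ := hst.iteration hθ hit
    obtain ⟨st'', T, hl, hr, hh', hT⟩ := ih st' h₃ (by omega)
    refine ⟨st'', _, .next h₁ hl, hr.head hit, hh', ?_⟩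
    rw [add_mul (k + 1) 1]
    omega

theorem exists_sspTerminates (hN : N.Connected) (hθ : ∀ e, ConvexOn ℝ Set.univ (θ e))
    {xs : Fin m → ℤ} (hxs : IsTermwiseMin θ xs) {search : Search} {S : ℕ → ℕ → ℕ}
    (hsearch : IsShortestPathSearch search) (hS : IsSearchTime search S) :
    ∃ (st : SSPState n m) (k T : ℕ), SSPTerminates search N θ xs st k T ∧
      Run N θ k ⟨xs, fun _ => 0⟩ st ∧ (k : ℝ) = totalExcess N xs ∧
      IsOptimalCirculation N θ st.x ∧ T ≤ 10 * (k + 1) * S n (2 * m) := by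
  have hst : DualFeasible N θ xs fun _ => 0 := hxs.dualFeasible
  obtain ⟨st, T, hl, hr, hh, hT⟩ :=
    exists_loopRuns hN hθ hsearch hS (posExcess N xs) ⟨xs, fun _ => 0⟩ hst rfl
  have hopt := (Run.dualFeasible (st := ⟨xs, fun _ => 0⟩) hθ hst hr).1.isOptimal hθ hh.isCirculation
  have hG := (totalExcess_eq N xs).symm
  refine ⟨st, posExcess N xs, (initProg (n := n) xs).steps + T, ⟨T, hl, rfl⟩, hr, hG, hopt, ?_⟩
  -- Needed to absorb the additive 1 into `S n (2 * m)`, which is at least `n + 2 * m`.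
  have hn : 0 < n := by
    have := (Nat.card_eq_one_iff_unique.1 hN).2
    obtain ⟨q⟩ := this
    induction q using Quot.ind with
    | mk i => exact i.pos
  have hsize := (hS n (2 * m)).1
  have hinit : (initProg (n := n) xs).steps = m + n := by simp [initProg]
  rw [hinit]
  calc m + n + T
      ≤ (posExcess N xs + 1) * (m + n) +
          (posExcess N xs + 1) * (5 * n + 8 * m + 1 + S n (2 * m)) :=
        add_le_add (Nat.le_mul_of_pos_left _ (Nat.succ_pos _)) hT
    _ = (posExcess N xs + 1) * (6 * n + 9 * m + 1 + S n (2 * m)) := by ring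
    _ ≤ (posExcess N xs + 1) * (10 * S n (2 * m)) := Nat.mul_le_mul_left _ (by omega)
    _ = 10 * (posExcess N xs + 1) * S n (2 * m) := by ring

end Program
-- Assembly of the four claims with one common constant
theorem mainTheorem2 :
    ∃ C : ℕ,
      -- arbitrary convex summands with a minimum
      (∀ (n m : ℕ) (N : Net n m) (θ : Fin m → ℝ → ℝ), N.Connected →
        (∀ e, ConvexOn ℝ Set.univ (θ e)) → (∀ e, ∃ y, IsMinOn (θ e) Set.univ y) →
        (∃ xs, IsTermwiseMin θ xs) ∧
        ∀ xs, IsTermwiseMin θ xs →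
          -- every run keeps dual feasibility, cannot get stuck, stops after exactly `G(xs)`
          -- iterations, and ends with an optimal circulation
          (∀ (k : ℕ) (st : SSPState n m), Run N θ k ⟨xs, fun _ => 0⟩ st →
            DualFeasible N θ st.x st.pot ∧
            (k : ℝ) ≤ totalExcess N xs ∧
            (Halted N st ↔ (k : ℝ) = totalExcess N xs) ∧
            (¬ Halted N st → ∃ st', Iteration N θ st st') ∧
            (Halted N st → IsOptimalCirculation N θ st.x)) ∧
          -- running time
          (∀ (search : Search) (S : ℕ → ℕ → ℕ),
            IsShortestPathSearch search → IsSearchTime search S →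
            ∃ (st : SSPState n m) (k T : ℕ), SSPTerminates search N θ xs st k T ∧
              Run N θ k ⟨xs, fun _ => 0⟩ st ∧ (k : ℝ) = totalExcess N xs ∧
              IsOptimalCirculation N θ st.x ∧
              T ≤ C * (k + 1) * S n (2 * m)) ∧
          -- the number of searches is at most `|E|` if the real minimisers form a circulation
          (∀ y : Fin m → ℝ, IsCirculation N y → (∀ e z, z ≠ y e → θ e (y e) < θ e z) →
            totalExcess N xs ≤ m)) ∧
      -- reduction for planar graphs
      (∀ (v m f : ℕ) (D : Net v m) (P : PlaneEmbedding D f) (θ : Fin m → ℝ → ℝ)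
        (x : Fin m → ℤ), IsOptimalCirculation P.dual θ x →
        (∃ h, IsPotentialDifference D x h) ∧
        ∀ h, IsPotentialDifference D x h →
          ∀ h', surfaceEnergy D θ h ≤ surfaceEnergy D θ h') ∧
      -- the disordered solid-on-solid model
      (∀ (v m f : ℕ) (D : Net v m) (P : PlaneEmbedding D f) (d : Fin v → ℝ) (xs : Fin m → ℤ),
        IsTermwiseMin (sosTheta D d) xs →
        totalExcess P.dual xs ≤ m ∧
        ∀ (search : Search) (S : ℕ → ℕ → ℕ),
          IsShortestPathSearch search → IsSearchTime search S →
          ∃ (st : SSPState f m) (k T : ℕ),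
            SSPTerminates search P.dual (sosTheta D d) xs st k T ∧
            (k : ℝ) = totalExcess P.dual xs ∧ k ≤ m ∧
            IsOptimalCirculation P.dual (sosTheta D d) st.x ∧
            (∃ h, IsPotentialDifference D st.x h) ∧
            (∀ h, IsPotentialDifference D st.x h → ∀ h', sosEnergy D d h ≤ sosEnergy D d h') ∧
            (0 < m → T ≤ C * m * S f (2 * m))) ∧
      -- a concrete search, which makes the total time polynomial
      IsShortestPathSearch bellmanFord ∧
      IsSearchTime bellmanFord (fun n m => C * (n + 1) * (m + 1)) ∧
      (∀ (v m f : ℕ) (D : Net v m) (P : PlaneEmbedding D f) (d : Fin v → ℝ) (xs : Fin m → ℤ),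
        IsTermwiseMin (sosTheta D d) xs → 0 < m →
        ∃ (st : SSPState f m) (k T : ℕ),
          SSPTerminates bellmanFord P.dual (sosTheta D d) xs st k T ∧
          IsOptimalCirculation P.dual (sosTheta D d) st.x ∧
          T ≤ C * f * m ^ 2) := by
  have hBF := isShortestPathSearch_bellmanFord
  -- The largest demand is the final estimate, which needs `10 * 2 * 4 * 2 * 3 = 480`.
  refine ⟨600, ?_, ?_, ?_, hBF, isSearchTime_bellmanFord (by norm_num), ?_⟩
  · intro n m N θ hN hθ hmin
    refine ⟨exists_isTermwiseMin hθ hmin, fun xs hxs => ⟨fun k st hrun => ?_, ?_, ?_⟩⟩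
    · obtain ⟨h₁, h₂⟩ := Run.dualFeasible (st := ⟨xs, fun _ => 0⟩) hθ hxs.dualFeasible hrun
      replace h₂ : posExcess N st.x + k = posExcess N xs := h₂
      rw [totalExcess_eq]
      refine ⟨h₁, by exact_mod_cast (by omega), ?_, h₁.exists_iteration hN,
        fun h => h₁.isOptimal hθ h.isCirculation⟩
      rw [halted_iff, Nat.cast_inj]
      omega
    · intro search S hsearch hS
      obtain ⟨st, k, T, h₁, h₂, h₃, h₄, h₅⟩ := exists_sspTerminates hN hθ hxs hsearch hS
      exact ⟨st, k, T, h₁, h₂, h₃, h₄, h₅.trans (by gcongr; norm_num)⟩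
    · intro y hy hmin'
      exact totalExcess_le hθ hxs hy hmin'
  · intro v m f D P θ x hx
    exact ⟨P.exists_isPotentialDifference hx.1, fun h hh h' => P.surfaceEnergy_le hx hh h'⟩
  · intro v m f D P d xs hxs
    have hG := P.totalExcess_sos_le hxs
    refine ⟨hG, fun search S hsearch hS => ?_⟩
    obtain ⟨st, k, T, h₁, -, h₃, h₄, h₅⟩ :=
      exists_sspTerminates (N := P.dual) P.dual_connected (convexOn_sosTheta D d) hxs hsearch hS
    have hk : k ≤ m := by rw [← h₃] at hG; exact_mod_cast hG
    refine ⟨st, k, T, h₁, h₃, hk, h₄, P.exists_isPotentialDifference h₄.1, fun h hh h' => ?_,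
      fun hm => h₅.trans ?_⟩
    · rw [sosEnergy_eq, sosEnergy_eq]
      exact P.surfaceEnergy_le h₄ hh h'
    · exact Nat.mul_le_mul_right _ (by omega)
  · intro v m f D P d xs hxs hm
    obtain ⟨st, k, T, h₁, -, h₃, h₄, h₅⟩ :=
      exists_sspTerminates (N := P.dual) P.dual_connected (convexOn_sosTheta D d) hxs hBF
        (isSearchTime_bellmanFord le_rfl)
    have hG := P.totalExcess_sos_le hxs
    have hk : k ≤ m := by rw [← h₃] at hG; exact_mod_cast hG
    -- An edge has a dart, and the dart has a face; hence `f + 1 ≤ 2 * f` below.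
    have hf : 0 < f := (P.face (⟨0, hm⟩, true)).pos
    refine ⟨st, k, T, h₁, h₄, h₅.trans ?_⟩
    calc 10 * (k + 1) * (4 * (f + 1) * (2 * m + 1))
        ≤ 10 * (2 * m) * (4 * (2 * f) * (3 * m)) := by gcongr <;> omega
      _ ≤ 600 * f * m ^ 2 := by nlinarith
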